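/- Let $n\ge 1$ and let $E_0,E_1$ be unitary $n\times n$ complex matrices such that $E_0^\dagger E_1$ is a Hadamard matrix, i.e. it is unitary and all its entries have absolute value $1/\sqrt n$. A database value $d$ is drawn uniformly from $n$ possible values, an encoding $i\in\{0,1\}$ is chosen uniformly and independently of $d$, and the pure state $E_i\hat e_d$ (column $d$ of $E_i$) is sent to a user, who measures it without knowing $i$ and is told $i$ afterwards. Let $R_1,\dots,R_N$ be any POVM, i.e. $n\times n$ complex matrices with $\sum_j R_j^\dagger R_j=I$ and $x^\dagger R_j^\dagger R_j x\ge 0$ for all $j$ and all $x\in\mathbb C^n$. The probability of outcome $j$ is $P(j\mid d,i)=(E_i^\dagger R_j^\dagger R_jE_i)_{dd}$, and Bayes' rule gives the posterior distribution $P(d\mid j,i)=P(j\mid d,i)/\sum_{d'}P(j\mid d',i)$. Let $h_{j,i}=-\sum_d P(d\mid j,i)\log_2 P(d\mid j,i)$ be its entropy, let $h_j=(h_{j,0}+h_{j,1})/2$, and let $P(j\mid i)=\frac1n\sum_d P(j\mid d,i)$. Then: 1. for every outcome $j$ of positive probability, $h_{j,0}+h_{j,1}\ge \log_2 n$, and hence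 the information gain averaged over the encodings satisfies $\log_2 n-h_j\le \tfrac12\log_2 n$; 2. the expected information gain over encodings and outcomes satisfies $$\frac12\sum_{i\in\{0,1\}}\sum_{j} P(j\mid i)\,(\log_2 n-h_{j,i})\le \tfrac12\log_2 n ,$$ where outcomes of probability zero contribute $0$; 3. POVMs have no advantage over projective measurements: there is an orthonormal basis $(e_j)_{j=1}^n$ of $\mathbb C^n$ such that for the projective measurement $R_j=e_je_j^\dagger$ (which is a POVM) every outcome $j$ has positive probability, $h_{j,0}+h_{j,1}=\log_2 n$ and $\log_2 n-h_j=\tfrac12\log_2 n$, and the expected information gain in 2 equals $\tfrac12\log_2 n$. -/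

import Mathlib

open Matrix
open scoped ComplexOrder

noncomputable section

namespace DatabaseQuery

/-- A complex Hadamard matrix in the normalization in which it is unitary: all entries have
modulus `1 / √n`, where `n` is the size of the matrix. -/
def IsHadamard {ι : Type*} [Fintype ι] [DecidableEq ι] (W : Matrix ι ι ℂ) : Prop :=
  W ∈ unitaryGroup ι ℂ ∧ ∀ a b, ‖W a b‖ = 1 / Real.sqrt (Fintype.card ι)

/-- Shannon entropy in bits, with the usual convention `0 log 0 = 0`. -/
def entropy {ι : Type*} [Fintype ι] (p : ι → ℝ) : ℝ :=
  -∑ d, p d * Real.logb 2 (p d)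

/-- A finite family of measurement operators `R j` is a POVM: the operators `(R j)ᴴ * R j` are
nonnegative and sum to the identity. The `R j` need not be Hermitian, orthogonal or invertible. -/
structure IsPOVM {ι κ : Type*} [Fintype ι] [DecidableEq ι] [Fintype κ]
    (R : κ → Matrix ι ι ℂ) : Prop where
  complete : ∑ j, (R j)ᴴ * R j = 1
  nonneg : ∀ j (x : ι → ℂ), 0 ≤ star x ⬝ᵥ (((R j)ᴴ * R j) *ᵥ x)

/-- The von Neumann measurement in the orthonormal basis formed by the columns `e j` of a unitary
matrix `V`: the operators are the projections `e j * (e j)ᴴ`. -/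
def projectiveMeasurement {ι : Type*} (V : Matrix ι ι ℂ) (j : ι) : Matrix ι ι ℂ :=
  vecMulVec (V.col j) (star (V.col j))

/-- The probability `⟨ψ| Rᴴ R |ψ⟩` of the outcome with measurement operator `R` in the pure
state `ψ`. -/
def bornProb {ι : Type*} [Fintype ι] (R : Matrix ι ι ℂ) (ψ : ι → ℂ) : ℝ :=
  (star ψ ⬝ᵥ ((Rᴴ * R) *ᵥ ψ)).re

/-- `P(j | d, i)`: the probability of outcome `j` when the database value is `d` and the encoding
is `E i`, so that the state sent to the user is `E i` applied to the basis vector of `d`. -/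
def likelihood {ι κ : Type*} [Fintype ι] [DecidableEq ι] (E : Fin 2 → Matrix ι ι ℂ)
    (R : κ → Matrix ι ι ℂ) (i : Fin 2) (d : ι) (j : κ) : ℝ :=
  bornProb (R j) (E i *ᵥ Pi.single d 1)

/-- The uniform prior `P(d) = 1 / n` on the database values. -/
def prior (ι : Type*) [Fintype ι] (_d : ι) : ℝ := 1 / (Fintype.card ι : ℝ)

/-- `P(j | i)`: the probability of outcome `j` given the encoding `i`, for a database value drawn
from the prior. -/
def condOutcomeProb {ι κ : Type*} [Fintype ι] [DecidableEq ι] (E : Fin 2 → Matrix ι ι ℂ)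
    (R : κ → Matrix ι ι ℂ) (i : Fin 2) (j : κ) : ℝ :=
  ∑ d, likelihood E R i d j * prior ι d

/-- `P(j)`: the probability of outcome `j` when in addition each of the two encodings is chosen
with probability `1 / 2`. -/
def outcomeProb {ι κ : Type*} [Fintype ι] [DecidableEq ι] (E : Fin 2 → Matrix ι ι ℂ)
    (R : κ → Matrix ι ι ℂ) (j : κ) : ℝ :=
  ∑ i, (1 / 2 : ℝ) * condOutcomeProb E R i j

/-- Bayes' rule: the posterior distribution `P(d | j, i)` of the database value `d`, given the
outcome `j` and the announced encoding `i`. -/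
def posterior {ι κ : Type*} [Fintype ι] [DecidableEq ι] (E : Fin 2 → Matrix ι ι ℂ)
    (R : κ → Matrix ι ι ℂ) (i : Fin 2) (j : κ) (d : ι) : ℝ :=
  likelihood E R i d j * prior ι d / ∑ d', likelihood E R i d' j * prior ι d'

/-- `h_{j,i}`: the entropy of the posterior distribution. -/
def posteriorEntropy {ι κ : Type*} [Fintype ι] [DecidableEq ι] (E : Fin 2 → Matrix ι ι ℂ)
    (R : κ → Matrix ι ι ℂ) (i : Fin 2) (j : κ) : ℝ :=
  entropy (posterior E R i j)

/-- The information gained from outcome `j`, averaged over the two equally likely encodings: the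
prior entropy minus `h_j = (h_{j,0} + h_{j,1}) / 2`. -/
def informationGain {ι κ : Type*} [Fintype ι] [DecidableEq ι] (E : Fin 2 → Matrix ι ι ℂ)
    (R : κ → Matrix ι ι ℂ) (j : κ) : ℝ :=
  entropy (prior ι) - (posteriorEntropy E R 0 j + posteriorEntropy E R 1 j) / 2

/-- The overall expected information gain: the expectation of the entropy reduction over the
encoding `i` (uniform) and the outcome `j` (with probability `P(j | i)`). -/
def expectedInformationGain {ι κ : Type*} [Fintype ι] [DecidableEq ι] [Fintype κ]
    (E : Fin 2 → Matrix ι ι ℂ) (R : κ → Matrix ι ι ℂ) : ℝ :=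
  ∑ i, (1 / 2 : ℝ) *
    ∑ j, condOutcomeProb E R i j * (entropy (prior ι) - posteriorEntropy E R i j)

end DatabaseQuery

end

/-! Fix an outcome `j` and put `A = R j * E 0`, `W = (E 0)ᴴ * E 1`, so that `R j * E 1 = A * W`. The
two posteriors are the squared column norms of `A` and `A * W` over their common total, and the
entropy bound is the Maassen-Uffink inequality for a possibly mixed state, with constant `K = 1 /
√n` bounding the entries of `W` (`logb_card_le_entropy_add_entropy`).

That inequality comes from interpolation (`sum_mul_log_add_sum_mul_log_le`): an entire function `F`
with `F 0 = 1` is bounded by `1` on `re z = 0` (unitarity) and by `K` on `re z = 1` (entry bound),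
so `re (F x) ≤ K ^ x` on `[0, 1]`. Both sides agree at `0`; comparing derivatives there gives the
entropies.

The outcome is independent of the encoding, so the expected gain is an average of the gains per
outcome. Measuring in the basis `E 0` attains equality. -/

namespace DatabaseQuery

/-! ### Three lines inequality and its derivative -/

section Interpolation

variable {ι κ : Type*} [Fintype ι] [Fintype κ]

/-- The entropic uncertainty bound behind the Maassen-Uffink inequality, in a form that only
mentions a complex coupling `c` of two distributions `p` and `q`. It is the derivative at `0` of
the three lines inequality for `z ↦ ∑ d, ∑ k, c d k * (p d * q k) ^ (z / 2)`. -/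
theorem sum_mul_log_add_sum_mul_log_le {p : ι → ℝ} {q : κ → ℝ} {c : ι → κ → ℂ} {K : ℝ}
    (hp : ∀ d, 0 ≤ p d) (hq : ∀ k, 0 ≤ q k) (hp1 : ∑ d, p d = 1) (hq1 : ∑ k, q k = 1)
    (hK : 0 < K) (hc : ∀ d k, ‖c d k‖ ≤ K * (Real.sqrt (p d) * Real.sqrt (q k)))
    (hcp : ∀ d, ∑ k, c d k = p d) (hcq : ∀ k, ∑ d, c d k = q k)
    (hphase : ∀ (u : ι → ℂ) (v : κ → ℂ), (∀ d, ‖u d‖ = 1) → (∀ k, ‖v k‖ = 1) →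
      ‖∑ d, ∑ k, u d * v k * c d k‖ ≤ 1) :
    ∑ d, p d * Real.log (p d) + ∑ k, q k * Real.log (q k) ≤ 2 * Real.log K := by
  set s : ι → κ → ℝ := fun d k => (Real.log (p d) + Real.log (q k)) / 2 with hs
  set F : ℂ → ℂ := fun z => ∑ d, ∑ k, c d k * Complex.exp (z * s d k) with hF
  have hnorm : ∀ z : ℂ, ∀ d k, ‖Complex.exp (z * s d k)‖ = Real.exp (z.re * s d k) := by
    intro z d k
    rw [Complex.norm_exp, Complex.re_mul_ofReal]
  have hdiff : Differentiable ℂ F := by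
    simp only [hF]
    fun_prop
  have hbdd : BddAbove ((norm ∘ F) '' Complex.HadamardThreeLines.verticalClosedStrip 0 1) := by
    refine ⟨∑ d, ∑ k, ‖c d k‖ * Real.exp |s d k|, ?_⟩
    rintro _ ⟨z, hz, rfl⟩
    obtain ⟨hz0, hz1⟩ := hz
    refine (norm_sum_le _ _).trans (Finset.sum_le_sum fun d _ => ?_)
    refine (norm_sum_le _ _).trans (Finset.sum_le_sum fun k _ => ?_)
    rw [norm_mul, hnorm]
    gcongr
    calc z.re * s d k ≤ |z.re * s d k| := le_abs_self _
      _ = z.re * |s d k| := by rw [abs_mul, abs_of_nonneg hz0]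
      _ ≤ 1 * |s d k| := by gcongr
      _ = |s d k| := one_mul _
  have hleft : ∀ z ∈ Complex.re ⁻¹' {(0 : ℝ)}, ‖F z‖ ≤ 1 := by
    intro z hz
    have hz : z.re = 0 := hz
    have h1 : ∀ x : ℝ, ‖Complex.exp (z * x)‖ = 1 := by
      intro x
      rw [Complex.norm_exp, Complex.re_mul_ofReal, hz, zero_mul, Real.exp_zero]
    -- On the imaginary axis the exponential splits into a phase in `d` times a phase in `k`.
    convert hphase (fun d => Complex.exp (z * (Real.log (p d) / 2 : ℝ)))
      (fun k => Complex.exp (z * (Real.log (q k) / 2 : ℝ))) (fun _ => h1 _) (fun _ => h1 _)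
      using 2
    refine Finset.sum_congr rfl fun d _ => Finset.sum_congr rfl fun k _ => ?_
    rw [← Complex.exp_add, mul_comm]
    congr 2
    simp only [hs]
    push_cast
    ring
  have hright : ∀ z ∈ Complex.re ⁻¹' {(1 : ℝ)}, ‖F z‖ ≤ K := by
    intro z hz
    have hz : z.re = 1 := hz
    calc ‖F z‖ ≤ ∑ d, ∑ k, K * (p d * q k) := by
          refine (norm_sum_le _ _).trans (Finset.sum_le_sum fun d _ => ?_)
          refine (norm_sum_le _ _).trans (Finset.sum_le_sum fun k _ => ?_)
          rw [norm_mul, hnorm, hz, one_mul]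
          have hcdk := hc d k
          -- Since `Real.log 0 = 0`, the exponential is not `√p * √q` at a zero weight; there `hc`
          -- forces `c d k = 0`.
          rcases (hp d).eq_or_lt with h | h
          · rw [← h, Real.sqrt_zero, zero_mul, mul_zero] at hcdk
            rw [le_antisymm hcdk (norm_nonneg _), ← h]
            simp
          rcases (hq k).eq_or_lt with h' | h'
          · rw [← h', Real.sqrt_zero, mul_zero, mul_zero] at hcdk
            rw [le_antisymm hcdk (norm_nonneg _), ← h']
            simp
          have he : Real.exp (s d k) = Real.sqrt (p d) * Real.sqrt (q k) := by
            rw [← Real.exp_log (Real.sqrt_pos.2 h), ← Real.exp_log (Real.sqrt_pos.2 h'),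
              ← Real.exp_add, Real.log_sqrt h.le, Real.log_sqrt h'.le]
            simp only [hs]
            ring_nf
          rw [he]
          calc _ ≤ K * (Real.sqrt (p d) * Real.sqrt (q k)) *
                (Real.sqrt (p d) * Real.sqrt (q k)) := by gcongr
            _ = K * ((Real.sqrt (p d) * Real.sqrt (p d)) *
                (Real.sqrt (q k) * Real.sqrt (q k))) := by ring
            _ = K * (p d * q k) := by
                rw [Real.mul_self_sqrt h.le, Real.mul_self_sqrt h'.le]
      _ = K * ((∑ d, p d) * ∑ k, q k) := by
          rw [Finset.sum_mul_sum, Finset.mul_sum]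
          simp only [Finset.mul_sum]
      _ = K := by rw [hp1, hq1, one_mul, mul_one]
  have hinterp : ∀ x ∈ Set.Icc (0 : ℝ) 1, (F x).re ≤ K ^ x := by
    intro x hx
    have h := Complex.HadamardThreeLines.norm_le_interp_of_mem_verticalClosedStrip'
      (z := (x : ℂ)) (f := F) zero_lt_one (by simpa [Complex.HadamardThreeLines.verticalClosedStrip] using hx)
      hdiff.diffContOnCl hbdd hleft hright
    rw [Real.one_rpow, one_mul, Complex.ofReal_re, sub_zero, sub_zero, div_one] at h
    exact (Complex.re_le_norm _).trans h
  have hF' : HasDerivAt F (∑ d, ∑ k, c d k * s d k) ((0 : ℝ) : ℂ) := by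
    have h : ∀ d k, HasDerivAt (fun z : ℂ => c d k * Complex.exp (z * s d k)) (c d k * s d k)
        ((0 : ℝ) : ℂ) := by
      intro d k
      have := (((hasDerivAt_id ((0 : ℝ) : ℂ)).mul_const (s d k : ℂ)).cexp).const_mul (c d k)
      simpa using this
    exact HasDerivAt.fun_sum fun d _ => HasDerivAt.fun_sum fun k _ => h d k
  have hg : HasDerivAt (fun x : ℝ => K ^ x - (F x).re)
      (Real.log K - (∑ d, ∑ k, c d k * s d k : ℂ).re) 0 := by
    have h1 := hF'.real_of_complex
    have h2 := (hasDerivAt_id (0 : ℝ)).const_rpow hK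
    simpa using h2.fun_sub h1
  -- The marginals of `c` turn the derivative into half the sum of the negative entropies.
  have hval : (∑ d, ∑ k, c d k * s d k : ℂ) =
      ((∑ d, p d * Real.log (p d) + ∑ k, q k * Real.log (q k)) / 2 : ℝ) := by
    have h1 : (∑ d, ∑ k, c d k * (Real.log (p d) : ℂ)) = ∑ d, (p d : ℂ) * Real.log (p d) := by
      simp only [← Finset.sum_mul, hcp]
    have h2 : (∑ d, ∑ k, c d k * (Real.log (q k) : ℂ)) = ∑ k, (q k : ℂ) * Real.log (q k) := by
      rw [Finset.sum_comm]
      simp only [← Finset.sum_mul, hcq]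
    push_cast
    rw [← h1, ← h2, ← Finset.sum_add_distrib, Finset.sum_div]
    refine Finset.sum_congr rfl fun d _ => ?_
    rw [← Finset.sum_add_distrib, Finset.sum_div]
    refine Finset.sum_congr rfl fun k _ => ?_
    simp only [hs]
    push_cast
    ring
  have hF0 : (F (0 : ℝ)).re = 1 := by
    have : F (0 : ℝ) = 1 := by
      simp only [hF, Complex.ofReal_zero, zero_mul, Complex.exp_zero, mul_one, hcp]
      exact_mod_cast hp1
    rw [this, Complex.one_re]
  -- `K ^ x - re (F x)` vanishes at `0` and is nonnegative on `[0, 1]`, hence so is its right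
  -- derivative at `0`.
  have hnonneg : 0 ≤ Real.log K - (∑ d, ∑ k, c d k * s d k : ℂ).re := by
    refine ge_of_tendsto ((hasDerivWithinAt_iff_tendsto_slope' Set.self_notMem_Ioi).1
      (hg.hasDerivWithinAt (s := Set.Ioi 0))) ?_
    filter_upwards [Ioo_mem_nhdsGT (zero_lt_one (α := ℝ))] with x hx
    have hx' := hinterp x ⟨hx.1.le, hx.2.le⟩
    rw [slope_def_field, hF0, Real.rpow_zero]
    exact div_nonneg (by linarith) (by linarith [hx.1])
  rw [hval, Complex.ofReal_re] at hnonneg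
  linarith

end Interpolation

/-! ### Squared column norms -/

section SquaredNorms

variable {ι κ : Type*} [Fintype ι]

theorem re_conjTranspose_mul_self_apply (A : Matrix ι κ ℂ) (k : κ) :
    ((Aᴴ * A) k k).re = ∑ m, ‖A m k‖ ^ 2 := by
  rw [Matrix.mul_apply, Complex.re_sum]
  refine Finset.sum_congr rfl fun m _ => ?_
  rw [conjTranspose_apply, RCLike.star_def, ← Complex.normSq_eq_conj_mul_self,
    Complex.normSq_eq_norm_sq, Complex.ofReal_re]

theorem conjTranspose_mul_self_apply_eq_ofReal (A : Matrix ι κ ℂ) (k : κ) :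
    (Aᴴ * A) k k = ((∑ m, ‖A m k‖ ^ 2 : ℝ) : ℂ) := by
  rw [Matrix.mul_apply, Complex.ofReal_sum]
  refine Finset.sum_congr rfl fun m _ => ?_
  rw [conjTranspose_apply, RCLike.star_def, ← Complex.normSq_eq_conj_mul_self,
    Complex.normSq_eq_norm_sq]

theorem norm_sum_star_mul_le (f g : ι → ℂ) :
    ‖∑ m, star (f m) * g m‖ ≤ Real.sqrt (∑ m, ‖f m‖ ^ 2) * Real.sqrt (∑ m, ‖g m‖ ^ 2) := by
  calc ‖∑ m, star (f m) * g m‖ ≤ ∑ m, ‖f m‖ * ‖g m‖ := by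
        refine (norm_sum_le _ _).trans_eq (Finset.sum_congr rfl fun m _ => ?_)
        rw [norm_mul, norm_star]
    _ ≤ _ := Real.sum_mul_le_sqrt_mul_sqrt _ _ _

/-- The total squared norm of the entries is invariant under right multiplication by a unitary. -/
theorem sum_norm_sq_mul_unitary [Fintype κ] [DecidableEq κ] (A : Matrix ι κ ℂ)
    {W : Matrix κ κ ℂ} (hW : W ∈ unitaryGroup κ ℂ) :
    ∑ k, ∑ m, ‖(A * W) m k‖ ^ 2 = ∑ k, ∑ m, ‖A m k‖ ^ 2 := by
  have h : ∀ B : Matrix ι κ ℂ, ∑ k, ∑ m, ‖B m k‖ ^ 2 = (Bᴴ * B).trace.re := by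
    intro B
    simp only [Matrix.trace, Matrix.diag_apply, Complex.re_sum, re_conjTranspose_mul_self_apply]
  have hW' : W * Wᴴ = 1 := mem_unitaryGroup_iff.1 hW
  rw [h, h, conjTranspose_mul, Matrix.mul_assoc, trace_mul_comm, ← Matrix.mul_assoc,
    Matrix.mul_assoc _ W, hW', Matrix.mul_one]

end SquaredNorms

/-! ### Maassen-Uffink inequality -/

section Uncertainty

variable {ι κ : Type*} [Fintype ι] [DecidableEq ι] [Nonempty ι] [Fintype κ]

/-- The Maassen-Uffink inequality for a possibly mixed state: if `A` and `A * W` both have total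
squared norm `T`, then the normalized squared norms of their columns have entropies that add up
to at least `log n`. -/
theorem logb_card_le_entropy_add_entropy (A : Matrix κ ι ℂ) {W : Matrix ι ι ℂ}
    (hW : IsHadamard W) {T : ℝ} (hT : 0 < T) (hAT : ∑ d, ∑ m, ‖A m d‖ ^ 2 = T) :
    Real.logb 2 (Fintype.card ι) ≤
      entropy (fun d => (∑ m, ‖A m d‖ ^ 2) / T) +
        entropy (fun k => (∑ m, ‖(A * W) m k‖ ^ 2) / T) := by
  obtain ⟨hWu, hWn⟩ := hW
  have hWW : W * Wᴴ = 1 := mem_unitaryGroup_iff.1 hWu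
  set B := A * W with hB
  have hBT : ∑ k, ∑ m, ‖B m k‖ ^ 2 = T := (sum_norm_sq_mul_unitary A hWu).trans hAT
  have hTc : (T : ℂ) ≠ 0 := by exact_mod_cast hT.ne'
  have hcard : (0 : ℝ) < Fintype.card ι := by exact_mod_cast Fintype.card_pos
  -- The marginals of `c` are the diagonals of `W * Bᴴ * A = Aᴴ * A` and `Bᴴ * A * W = Bᴴ * B`,
  -- divided by `T`.
  have key := sum_mul_log_add_sum_mul_log_le
    (p := fun d => (∑ m, ‖A m d‖ ^ 2) / T) (q := fun k => (∑ m, ‖B m k‖ ^ 2) / T)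
    (c := fun d k => W d k * (Bᴴ * A) k d / T) (K := 1 / Real.sqrt (Fintype.card ι))
    (fun d => by positivity) (fun k => by positivity)
    (by rw [← Finset.sum_div, hAT, div_self hT.ne'])
    (by rw [← Finset.sum_div, hBT, div_self hT.ne']) (by positivity)
    (by
      intro d k
      rw [norm_div, norm_mul, hWn, Complex.norm_real, Real.norm_of_nonneg hT.le,
        Real.sqrt_div (by positivity), Real.sqrt_div (by positivity), div_mul_div_comm,
        Real.mul_self_sqrt hT.le, mul_div_assoc]
      gcongr
      rw [mul_comm]
      exact norm_sum_star_mul_le (fun m => B m k) (fun m => A m d))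
    (by
      intro d
      rw [← Finset.sum_div, ← Matrix.mul_apply, hB, conjTranspose_mul, ← Matrix.mul_assoc,
        ← Matrix.mul_assoc, hWW, Matrix.one_mul, conjTranspose_mul_self_apply_eq_ofReal,
        Complex.ofReal_div])
    (by
      intro k
      simp only [mul_comm (W _ k)]
      rw [← Finset.sum_div, ← Matrix.mul_apply, Matrix.mul_assoc, ← hB,
        conjTranspose_mul_self_apply_eq_ofReal, Complex.ofReal_div])
    (by
      intro u v hu hv
      -- With `u` absorbed into the columns of `A` and `v` into those of `B`, the sum is an inner
      -- product of two matrices of total squared norm `T`, divided by `T`.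
      set C : Matrix κ ι ℂ := Matrix.of (fun m d => A m d * u d) with hC
      have hCT : ∑ k, ∑ m, ‖(C * W) m k‖ ^ 2 = T := by
        rw [sum_norm_sq_mul_unitary C hWu, ← hAT]
        simp [hC, hu]
      have hsum : ∑ d, ∑ k, u d * v k * (W d k * (Bᴴ * A) k d / T) =
          (∑ x : ι × κ, star (star (v x.1) * B x.2 x.1) * (C * W) x.2 x.1) / T := by
        simp only [Fintype.sum_prod_type, Matrix.mul_apply, conjTranspose_apply, hC,
          Matrix.of_apply, Finset.mul_sum, Finset.sum_div, star_mul, star_star]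
        rw [Finset.sum_comm]
        refine Finset.sum_congr rfl fun k _ => ?_
        rw [Finset.sum_comm]
        refine Finset.sum_congr rfl fun m _ => Finset.sum_congr rfl fun d _ => ?_
        ring
      rw [hsum, norm_div, Complex.norm_real, Real.norm_of_nonneg hT.le, div_le_one hT]
      refine (norm_sum_star_mul_le _ _).trans_eq ?_
      simp only [norm_mul, norm_star, hv, one_mul, Fintype.sum_prod_type]
      rw [hBT, hCT, Real.mul_self_sqrt hT.le])
  rw [one_div, Real.log_inv, Real.log_sqrt hcard.le] at key
  have hlog2 : 0 < Real.log 2 := Real.log_pos one_lt_two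
  simp only [entropy, Real.logb, mul_div_assoc', ← Finset.sum_div]
  rw [← neg_div, ← neg_div, ← add_div]
  gcongr
  linarith

end Uncertainty

/-! ### Outcome probabilities, posteriors and information gain -/

section Measurement

variable {ι κ : Type*} [Fintype ι] [DecidableEq ι]

theorem likelihood_eq_sum_norm_sq (E : Fin 2 → Matrix ι ι ℂ) (R : κ → Matrix ι ι ℂ) (i : Fin 2)
    (d : ι) (j : κ) : likelihood E R i d j = ∑ m, ‖(R j * E i) m d‖ ^ 2 := by
  rw [likelihood, bornProb, ← re_conjTranspose_mul_self_apply, conjTranspose_mul,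
    star_mulVec, ← dotProduct_mulVec, mulVec_mulVec, mulVec_mulVec, mulVec_single_one,
    ← Pi.single_star, star_one, single_one_dotProduct]
  simp only [Matrix.col_apply, Matrix.mul_assoc]

theorem entropy_const_inv_card {ι : Type*} [Fintype ι] [Nonempty ι] :
    entropy (fun _ : ι => 1 / (Fintype.card ι : ℝ)) = Real.logb 2 (Fintype.card ι) := by
  have hcard : (Fintype.card ι : ℝ) ≠ 0 := by exact_mod_cast Fintype.card_ne_zero
  simp only [entropy, one_div, Real.logb_inv, Finset.sum_const, Finset.card_univ, nsmul_eq_mul]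
  rw [← mul_assoc, mul_inv_cancel₀ hcard]
  ring

theorem entropy_prior {ι : Type*} [Fintype ι] [Nonempty ι] :
    entropy (prior ι) = Real.logb 2 (Fintype.card ι) :=
  entropy_const_inv_card

theorem entropy_single (a : ι) : entropy (fun d => if a = d then (1 : ℝ) else 0) = 0 := by
  simp [entropy]

variable {E : Fin 2 → Matrix ι ι ℂ}

theorem sum_likelihood (hE : ∀ i, E i ∈ unitaryGroup ι ℂ) (R : κ → Matrix ι ι ℂ) (i : Fin 2)
    (j : κ) : ∑ d, likelihood E R i d j = ∑ d, ∑ m, ‖R j m d‖ ^ 2 := by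
  simp only [likelihood_eq_sum_norm_sq, sum_norm_sq_mul_unitary _ (hE i)]

theorem condOutcomeProb_eq (hE : ∀ i, E i ∈ unitaryGroup ι ℂ) (R : κ → Matrix ι ι ℂ)
    (i : Fin 2) (j : κ) :
    condOutcomeProb E R i j = (∑ d, ∑ m, ‖R j m d‖ ^ 2) / Fintype.card ι := by
  simp only [condOutcomeProb, prior]
  rw [← Finset.sum_mul, sum_likelihood hE, mul_one_div]

/-- A uniform prior makes the average state maximally mixed under either encoding, so the outcome
says nothing about `i`. -/
theorem outcomeProb_eq_condOutcomeProb (hE : ∀ i, E i ∈ unitaryGroup ι ℂ)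
    (R : κ → Matrix ι ι ℂ) (i : Fin 2) (j : κ) :
    outcomeProb E R j = condOutcomeProb E R i j := by
  simp only [outcomeProb, condOutcomeProb_eq hE, Fin.sum_univ_two]
  ring

theorem posterior_eq [Nonempty ι] (hE : ∀ i, E i ∈ unitaryGroup ι ℂ) (R : κ → Matrix ι ι ℂ)
    (i : Fin 2) (j : κ) :
    posterior E R i j =
      fun d => (∑ m, ‖(R j * E i) m d‖ ^ 2) / ∑ d', ∑ m, ‖R j m d'‖ ^ 2 := by
  have hcard : (1 / (Fintype.card ι : ℝ)) ≠ 0 := by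
    rw [one_div]
    exact inv_ne_zero (by exact_mod_cast Fintype.card_ne_zero)
  funext d
  simp only [posterior, prior]
  rw [← Finset.sum_mul, mul_div_mul_right _ _ hcard, sum_likelihood hE, likelihood_eq_sum_norm_sq]

/-- This is the trace of the completeness relation. -/
theorem sum_outcomeProb [Nonempty ι] [Fintype κ] (hE : ∀ i, E i ∈ unitaryGroup ι ℂ)
    {R : κ → Matrix ι ι ℂ} (hR : IsPOVM R) : ∑ j, outcomeProb E R j = 1 := by
  have hcard : (Fintype.card ι : ℝ) ≠ 0 := by exact_mod_cast Fintype.card_ne_zero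
  have h : ∑ j, ∑ d, ∑ m, ‖R j m d‖ ^ 2 = (Fintype.card ι : ℝ) := by
    have htr : (∑ j, (R j)ᴴ * R j).trace.re = Fintype.card ι := by
      rw [hR.complete, Matrix.trace_one, Complex.natCast_re]
    rw [Matrix.trace_sum, Complex.re_sum] at htr
    simpa only [Matrix.trace, Matrix.diag_apply, Complex.re_sum,
      re_conjTranspose_mul_self_apply] using htr
  simp only [outcomeProb_eq_condOutcomeProb hE R 0, condOutcomeProb_eq hE]
  rw [← Finset.sum_div, h, div_self hcard]

theorem expectedInformationGain_eq [Fintype κ] (hE : ∀ i, E i ∈ unitaryGroup ι ℂ)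
    (R : κ → Matrix ι ι ℂ) :
    expectedInformationGain E R = ∑ j, outcomeProb E R j * informationGain E R j := by
  simp only [expectedInformationGain, informationGain, Finset.mul_sum]
  rw [Finset.sum_comm]
  refine Finset.sum_congr rfl fun j _ => ?_
  rw [Fin.sum_univ_two, ← outcomeProb_eq_condOutcomeProb hE R 0,
    ← outcomeProb_eq_condOutcomeProb hE R 1]
  ring

theorem logb_card_le_posteriorEntropy_add [Nonempty ι] (hE : ∀ i, E i ∈ unitaryGroup ι ℂ)
    (hU : IsHadamard ((E 0)ᴴ * E 1)) (R : κ → Matrix ι ι ℂ) {j : κ}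
    (hj : 0 < outcomeProb E R j) :
    Real.logb 2 (Fintype.card ι) ≤ posteriorEntropy E R 0 j + posteriorEntropy E R 1 j := by
  have hcard : (0 : ℝ) < Fintype.card ι := by exact_mod_cast Fintype.card_pos
  rw [outcomeProb_eq_condOutcomeProb hE R 0, condOutcomeProb_eq hE,
    div_pos_iff_of_pos_right hcard] at hj
  have h := logb_card_le_entropy_add_entropy (R j * E 0) hU hj
    (sum_norm_sq_mul_unitary (R j) (hE 0))
  have hE0 : E 0 * (E 0)ᴴ = 1 := mem_unitaryGroup_iff.1 (hE 0)
  have hmul : R j * E 0 * ((E 0)ᴴ * E 1) = R j * E 1 := by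
    rw [Matrix.mul_assoc, ← Matrix.mul_assoc (E 0), hE0, Matrix.one_mul]
  rw [hmul] at h
  simpa only [posteriorEntropy, posterior_eq hE] using h

theorem informationGain_le_iff [Nonempty ι] (R : κ → Matrix ι ι ℂ) (j : κ) :
    informationGain E R j ≤ 1 / 2 * Real.logb 2 (Fintype.card ι) ↔
      Real.logb 2 (Fintype.card ι) ≤ posteriorEntropy E R 0 j + posteriorEntropy E R 1 j := by
  rw [informationGain, entropy_prior]
  constructor <;> intro h <;> linarith

theorem expectedInformationGain_le [Nonempty ι] [Fintype κ]
    (hE : ∀ i, E i ∈ unitaryGroup ι ℂ) (hU : IsHadamard ((E 0)ᴴ * E 1))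
    {R : κ → Matrix ι ι ℂ} (hR : IsPOVM R) :
    expectedInformationGain E R ≤ 1 / 2 * Real.logb 2 (Fintype.card ι) := by
  set g := 1 / 2 * Real.logb 2 (Fintype.card ι)
  rw [expectedInformationGain_eq hE, ← one_mul g, ← sum_outcomeProb hE hR, Finset.sum_mul]
  refine Finset.sum_le_sum fun j _ => ?_
  have h0 : 0 ≤ outcomeProb E R j := by
    rw [outcomeProb_eq_condOutcomeProb hE R 0, condOutcomeProb_eq hE]
    positivity
  -- The entropy bound needs positive probability; null outcomes contribute zero to both sides.
  rcases h0.eq_or_lt with h | h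
  · rw [← h, zero_mul, zero_mul]
  · exact mul_le_mul_of_nonneg_left ((informationGain_le_iff R j).2
      (logb_card_le_posteriorEntropy_add hE hU R h)) h0

end Measurement

/-! ### Projective measurements and sharpness -/

section Projective

variable {ι : Type*} [Fintype ι] [DecidableEq ι] {V : Matrix ι ι ℂ}

theorem sum_norm_sq_col (hV : V ∈ unitaryGroup ι ℂ) (j : ι) : ∑ m, ‖V m j‖ ^ 2 = 1 := by
  have h : Vᴴ * V = 1 := mem_unitaryGroup_iff'.1 hV
  rw [← re_conjTranspose_mul_self_apply, h, one_apply_eq, Complex.one_re]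

theorem projectiveMeasurement_mul_apply {ι : Type*} [Fintype ι] (V A : Matrix ι ι ℂ) (j m d : ι) :
    (projectiveMeasurement V j * A) m d = V m j * (Vᴴ * A) j d := by
  simp only [projectiveMeasurement, Matrix.mul_apply, vecMulVec_apply, Matrix.col_apply,
    Pi.star_apply, conjTranspose_apply, Finset.mul_sum, mul_assoc]

theorem sum_norm_sq_projectiveMeasurement_mul (hV : V ∈ unitaryGroup ι ℂ) (A : Matrix ι ι ℂ)
    (j d : ι) : ∑ m, ‖(projectiveMeasurement V j * A) m d‖ ^ 2 = ‖(Vᴴ * A) j d‖ ^ 2 := by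
  simp only [projectiveMeasurement_mul_apply, norm_mul, mul_pow]
  rw [← Finset.sum_mul, sum_norm_sq_col hV, one_mul]

theorem sum_norm_sq_projectiveMeasurement (hV : V ∈ unitaryGroup ι ℂ) (j : ι) :
    ∑ d, ∑ m, ‖projectiveMeasurement V j m d‖ ^ 2 = 1 := by
  -- Right multiplication by `V` keeps the total and reduces it to row `j` of `Vᴴ * V = 1`.
  rw [← sum_norm_sq_mul_unitary _ hV]
  have h : Vᴴ * V = 1 := mem_unitaryGroup_iff'.1 hV
  simp [sum_norm_sq_projectiveMeasurement_mul hV, h, Matrix.one_apply, apply_ite]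

theorem projectiveMeasurement_isPOVM (hV : V ∈ unitaryGroup ι ℂ) :
    IsPOVM (projectiveMeasurement V) where
  complete := by
    have h : V * Vᴴ = 1 := mem_unitaryGroup_iff.1 hV
    have h' : Vᴴ * V = 1 := mem_unitaryGroup_iff'.1 hV
    have hproj : ∀ j, (projectiveMeasurement V j)ᴴ * projectiveMeasurement V j =
        projectiveMeasurement V j := by
      intro j
      have hstar : (projectiveMeasurement V j)ᴴ = projectiveMeasurement V j := by
        simp [projectiveMeasurement, conjTranspose_vecMulVec]
      ext a b
      have hb : (Vᴴ * projectiveMeasurement V j) j b = star (V b j) := by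
        have hjj : ∑ a, star (V a j) * V a j = 1 := by
          simpa [Matrix.mul_apply] using congrFun (congrFun h' j) j
        simp only [projectiveMeasurement, Matrix.mul_apply, conjTranspose_apply, vecMulVec_apply,
          Matrix.col_apply, Pi.star_apply]
        simp only [← mul_assoc]
        rw [← Finset.sum_mul, hjj, one_mul]
      rw [hstar, projectiveMeasurement_mul_apply, hb]
      rfl
    ext a b
    simp only [hproj]
    rw [← h, Matrix.sum_apply, Matrix.mul_apply]
    rfl
  nonneg j x := (posSemidef_conjTranspose_mul_self _).dotProduct_mulVec_nonneg x

variable {E : Fin 2 → Matrix ι ι ℂ}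

theorem posteriorEntropy_projectiveMeasurement [Nonempty ι] (hE : ∀ i, E i ∈ unitaryGroup ι ℂ)
    (hV : V ∈ unitaryGroup ι ℂ) (i : Fin 2) (j : ι) :
    posteriorEntropy E (projectiveMeasurement V) i j =
      entropy (fun d => ‖(Vᴴ * E i) j d‖ ^ 2) := by
  simp only [posteriorEntropy, posterior_eq hE, sum_norm_sq_projectiveMeasurement hV,
    sum_norm_sq_projectiveMeasurement_mul hV, div_one]

theorem outcomeProb_projectiveMeasurement_pos [Nonempty ι] (hE : ∀ i, E i ∈ unitaryGroup ι ℂ)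
    (hV : V ∈ unitaryGroup ι ℂ) (j : ι) :
    0 < outcomeProb E (projectiveMeasurement V) j := by
  rw [outcomeProb_eq_condOutcomeProb hE _ 0, condOutcomeProb_eq hE,
    sum_norm_sq_projectiveMeasurement hV]
  exact one_div_pos.2 (by exact_mod_cast Fintype.card_pos)

/-- Measuring in the basis of the encoding `0` reveals everything when that encoding was used and
nothing when the other one was used, and so attains the uncertainty bound. -/
theorem posteriorEntropy_measure_first_encoding [Nonempty ι]
    (hE : ∀ i, E i ∈ unitaryGroup ι ℂ) (hU : IsHadamard ((E 0)ᴴ * E 1)) (j : ι) :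
    posteriorEntropy E (projectiveMeasurement (E 0)) 0 j +
      posteriorEntropy E (projectiveMeasurement (E 0)) 1 j = Real.logb 2 (Fintype.card ι) := by
  have h : (E 0)ᴴ * E 0 = 1 := mem_unitaryGroup_iff'.1 (hE 0)
  have h0 : (fun d => ‖((E 0)ᴴ * E 0) j d‖ ^ 2) = fun d => if j = d then (1 : ℝ) else 0 := by
    funext d
    rw [h, Matrix.one_apply]
    split_ifs <;> simp
  have h1 : (fun d => ‖((E 0)ᴴ * E 1) j d‖ ^ 2) = fun _ => 1 / (Fintype.card ι : ℝ) := by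
    funext d
    rw [hU.2, div_pow, one_pow, Real.sq_sqrt (Nat.cast_nonneg _)]
  rw [posteriorEntropy_projectiveMeasurement hE (hE 0),
    posteriorEntropy_projectiveMeasurement hE (hE 0), h0, h1, entropy_single,
    entropy_const_inv_card, zero_add]

end Projective

end DatabaseQuery

/-! ### The bound for POVMs and its attainment -/

theorem mainTheorem2 {ι : Type*} [Fintype ι] [DecidableEq ι] [Nonempty ι]
    (E : Fin 2 → Matrix ι ι ℂ) (hE : ∀ i, E i ∈ Matrix.unitaryGroup ι ℂ)
    (hU : DatabaseQuery.IsHadamard ((E 0)ᴴ * E 1)) :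
    (∀ (N : ℕ) (R : Fin N → Matrix ι ι ℂ), DatabaseQuery.IsPOVM R →
      (∀ j, 0 < DatabaseQuery.outcomeProb E R j →
        Real.logb 2 (Fintype.card ι) ≤
            DatabaseQuery.posteriorEntropy E R 0 j + DatabaseQuery.posteriorEntropy E R 1 j ∧
          DatabaseQuery.informationGain E R j ≤ 1 / 2 * Real.logb 2 (Fintype.card ι)) ∧
      DatabaseQuery.expectedInformationGain E R ≤ 1 / 2 * Real.logb 2 (Fintype.card ι)) ∧
    (∃ V ∈ Matrix.unitaryGroup ι ℂ,
      DatabaseQuery.IsPOVM (DatabaseQuery.projectiveMeasurement V) ∧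
      (∀ j, 0 < DatabaseQuery.outcomeProb E (DatabaseQuery.projectiveMeasurement V) j ∧
        DatabaseQuery.posteriorEntropy E (DatabaseQuery.projectiveMeasurement V) 0 j +
            DatabaseQuery.posteriorEntropy E (DatabaseQuery.projectiveMeasurement V) 1 j =
          Real.logb 2 (Fintype.card ι) ∧
        DatabaseQuery.informationGain E (DatabaseQuery.projectiveMeasurement V) j =
          1 / 2 * Real.logb 2 (Fintype.card ι)) ∧
      DatabaseQuery.expectedInformationGain E (DatabaseQuery.projectiveMeasurement V) =
        1 / 2 * Real.logb 2 (Fintype.card ι)) := by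
  refine ⟨fun N R hR => ⟨fun j hj => ?_, DatabaseQuery.expectedInformationGain_le hE hU hR⟩, ?_⟩
  · have h := DatabaseQuery.logb_card_le_posteriorEntropy_add hE hU R hj
    exact ⟨h, (DatabaseQuery.informationGain_le_iff R j).2 h⟩
  · have hPOVM := DatabaseQuery.projectiveMeasurement_isPOVM (hE 0)
    have hsum := DatabaseQuery.posteriorEntropy_measure_first_encoding hE hU
    have hgain : ∀ j, DatabaseQuery.informationGain E
        (DatabaseQuery.projectiveMeasurement (E 0)) j =
          1 / 2 * Real.logb 2 (Fintype.card ι) := by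
      intro j
      rw [DatabaseQuery.informationGain, hsum, DatabaseQuery.entropy_prior]
      ring
    refine ⟨E 0, hE 0, hPOVM, fun j =>
      ⟨DatabaseQuery.outcomeProb_projectiveMeasurement_pos hE (hE 0) j, hsum j, hgain j⟩, ?_⟩
    rw [DatabaseQuery.expectedInformationGain_eq hE]
    simp only [hgain]
    rw [← Finset.sum_mul, DatabaseQuery.sum_outcomeProb hE hPOVM, one_mul]
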